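/- Let $M$ be a positive $d\times d$ matrix-valued measure on the unit circle $\mathbb T$, normalised by $M(\mathbb T)=I_d$ and non-trivial, i.e. for every nonzero polynomial $P$ with $d\times d$ complex matrix coefficients $$\mathrm{Tr}\int_0^{2\pi} P(e^{i\theta})\,\mathrm dM(\theta)\,P(e^{i\theta})^*>0\quad\text{and}\quad \mathrm{Tr}\int_0^{2\pi} P(e^{i\theta})^*\,\mathrm dM(\theta)\,P(e^{i\theta})>0 .$$ Let $C_n=\int_0^{2\pi}e^{-in\theta}\,\mathrm dM(\theta)$, $n\in\mathbb Z$, be its moments. Let $F(z)=\int_0^{2\pi}\frac{e^{i\theta}+z}{e^{i\theta}-z}\,\mathrm dM(\theta)$, $|z|<1$, be its Herglotz function and $f$ its Schur function, determined by $F(z)=(I_d+zf(z))(I_d-zf(z))^{-1}$. The Verblunsky coefficients of $M$ are the matrices $\alpha_n=f_n(0)$, $n\ge 0$, given by the Schur algorithm $f_0=f$, $$f_{n+1}(z)=z^{-1}(\rho_n^R)^{-1}\,(f_n(z)-\alpha_n)\,(I_d-\alpha_n^*f_n(z))^{-1}\rho_n^L ,$$ where $\rho_n^L=(I_d-\alpha_n^*\alpha_n)^{1/2}$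 and $\rho_n^R=(I_d-\alpha_n\alpha_n^*)^{1/2}$ (the singularity of $f_{n+1}$ at $z=0$ being removed). Then for every $n\ge 1$ $$C_n=\rho_0^R\cdots\rho_{n-2}^R\,\alpha_{n-1}\,\rho_{n-2}^L\cdots\rho_0^L+\tilde R_n(\alpha_0,\dots,\alpha_{n-2},\alpha_0^*,\dots,\alpha_{n-2}^*),$$ where $\tilde R_n$ is a noncommutative rational function of its arguments and of their defect matrices: there is a noncommutative rational expression, built from complex scalars and the letters $\alpha_j,\alpha_j^*,\rho_j^L,\rho_j^R$ ($0\le j\le n-2$) by sums, products and inverses, which depends only on $n$ (not on $d$ or $M$), such that for every $d$ and every $M$ as above all inverses occurring in it exist at the Verblunsky coefficients of $M$ and its value there is $\tilde R_n$. -/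

import Mathlib

open MeasureTheory Filter Topology
open scoped Matrix MatrixOrder ComplexOrder

noncomputable section

namespace MatrixOPUC

/-! ### Matrix-valued measures on the unit circle -/

instance instMeasurableSpaceCircle : MeasurableSpace Circle := borel Circle

instance instBorelSpaceCircle : BorelSpace Circle := ⟨rfl⟩

/-- A (countably additive, finite) measure on the unit circle with values in the complex
`d × d` matrices. -/
abbrev MatrixMeasure (d : ℕ) : Type :=
  VectorMeasure Circle (Matrix (Fin d) (Fin d) ℂ)

variable {d : ℕ}

/-- The matrix measure takes positive semidefinite values. -/
def IsPositive (M : MatrixMeasure d) : Prop :=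
  ∀ s : Set Circle, MeasurableSet s → (M s).PosSemidef

/-- The total mass is the identity matrix. -/
def IsNormalized (M : MatrixMeasure d) : Prop :=
  M Set.univ = 1

/-- The complex measure `s ↦ (M s) i j`. -/
def entry (M : MatrixMeasure d) (i j : Fin d) : ComplexMeasure Circle :=
  M.mapRange (Matrix.entryAddMonoidHom ℂ i j) (continuous_id.matrix_elem i j)

/-- The integral of a complex function against a complex measure. -/
def cintegral (μ : ComplexMeasure Circle) (φ : Circle → ℂ) : ℂ :=
  μ.integral φ (ContinuousLinearMap.mul ℝ ℂ)

/-- `∫ φ dM` for a scalar function `φ`. -/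
def scalarIntegral (M : MatrixMeasure d) (φ : Circle → ℂ) : Matrix (Fin d) (Fin d) ℂ :=
  Matrix.of fun i j => cintegral (entry M i j) φ

/-- `∫ f dM g` for matrix functions `f` and `g`: the `(i, l)` entry is
`∑ j k, ∫ f i j * g k l dM j k`. -/
def sandwichIntegral (M : MatrixMeasure d) (f g : Circle → Matrix (Fin d) (Fin d) ℂ) :
    Matrix (Fin d) (Fin d) ℂ :=
  Matrix.of fun i l => ∑ j, ∑ k, cintegral (entry M j k) fun ζ => f ζ i j * g ζ k l

/-- The value at `ζ` of a polynomial with matrix coefficients, `∑ k, ζ ^ k • P_k`. -/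
def polyEval (P : Polynomial (Matrix (Fin d) (Fin d) ℂ)) (ζ : Circle) :
    Matrix (Fin d) (Fin d) ℂ :=
  P.sum fun k A => (ζ : ℂ) ^ k • A

/-- `‖P‖_L = (Tr ∫ P dM P^*)^{1/2}`. -/
def normL (M : MatrixMeasure d) (P : Polynomial (Matrix (Fin d) (Fin d) ℂ)) : ℝ :=
  √(sandwichIntegral M (fun ζ => polyEval P ζ) (fun ζ => (polyEval P ζ)ᴴ)).trace.re

/-- `‖P‖_R = (Tr ∫ P^* dM P)^{1/2}`. -/
def normR (M : MatrixMeasure d) (P : Polynomial (Matrix (Fin d) (Fin d) ℂ)) : ℝ :=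
  √(sandwichIntegral M (fun ζ => (polyEval P ζ)ᴴ) (fun ζ => polyEval P ζ)).trace.re

/-- Both norms are positive on nonzero matrix polynomials. -/
def IsNontrivial (M : MatrixMeasure d) : Prop :=
  ∀ P : Polynomial (Matrix (Fin d) (Fin d) ℂ), P ≠ 0 → 0 < normL M P ∧ 0 < normR M P

/-- The moments `C_n = ∫ e^{-inθ} dM(θ)`, `n ∈ ℤ`. -/
def moment (M : MatrixMeasure d) (n : ℤ) : Matrix (Fin d) (Fin d) ℂ :=
  scalarIntegral M fun ζ => (ζ : ℂ) ^ (-n)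

/-! ### Herglotz function, Schur function and Verblunsky coefficients -/

/-- The Herglotz function `F(z) = ∫ (e^{iθ} + z) / (e^{iθ} - z) dM(θ)` for `|z| < 1`. -/
def herglotz (M : MatrixMeasure d) (z : ℂ) : Matrix (Fin d) (Fin d) ℂ :=
  scalarIntegral M fun ζ => ((ζ : ℂ) + z) / ((ζ : ℂ) - z)

/-- The function equal to `z⁻¹ • g z` off the origin, and to the limit of this expression at the
origin (a removable singularity wherever this is used). -/
def divZ (g : ℂ → Matrix (Fin d) (Fin d) ℂ) : ℂ → Matrix (Fin d) (Fin d) ℂ :=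
  Function.update (fun z => z⁻¹ • g z) 0 (limUnder (𝓝[≠] (0 : ℂ)) fun z => z⁻¹ • g z)

/-- The Schur function `f` of `M`. It is the solution of
`F(z) = (1 + z f(z)) (1 - z f(z))⁻¹`, that is, of `z f(z) = (F(z) - 1) (F(z) + 1)⁻¹`,
where `|z| < 1`. -/
def schurFunction (M : MatrixMeasure d) : ℂ → Matrix (Fin d) (Fin d) ℂ :=
  divZ fun z => (herglotz M z - 1) * (herglotz M z + 1)⁻¹

/-- The left defect matrix `ρ^L = (1 - α^* α)^{1/2}`. -/
def rhoL (α : Matrix (Fin d) (Fin d) ℂ) : Matrix (Fin d) (Fin d) ℂ :=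
  CFC.sqrt (1 - αᴴ * α)

/-- The right defect matrix `ρ^R = (1 - α α^*)^{1/2}`. -/
def rhoR (α : Matrix (Fin d) (Fin d) ℂ) : Matrix (Fin d) (Fin d) ℂ :=
  CFC.sqrt (1 - α * αᴴ)

/-- One step of the Schur algorithm: with `α = f(0)`, the function
`z⁻¹ (ρ^R)⁻¹ (f(z) - α) (1 - α^* f(z))⁻¹ ρ^L`. -/
def schurStep (f : ℂ → Matrix (Fin d) (Fin d) ℂ) : ℂ → Matrix (Fin d) (Fin d) ℂ :=
  divZ fun z => (rhoR (f 0))⁻¹ * (f z - f 0) * (1 - (f 0)ᴴ * f z)⁻¹ * rhoL (f 0)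

/-- The Schur iterates `f_0 = f, f_1, f_2, …` of `M`. -/
def schurIterate (M : MatrixMeasure d) (n : ℕ) : ℂ → Matrix (Fin d) (Fin d) ℂ :=
  schurStep^[n] (schurFunction M)

/-- The Verblunsky coefficients `α_n = f_n(0)` of `M`. -/
def verblunsky (M : MatrixMeasure d) (n : ℕ) : Matrix (Fin d) (Fin d) ℂ :=
  schurIterate M n 0

/-! ### Noncommutative rational expressions -/

/-- Noncommutative rational expressions over `ℂ` in the letters `X`. -/
inductive NCRatExpr (X : Type) : Type
  | const (c : ℂ) : NCRatExpr X
  | var (x : X) : NCRatExpr X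
  | add (p q : NCRatExpr X) : NCRatExpr X
  | mul (p q : NCRatExpr X) : NCRatExpr X
  | inv (p : NCRatExpr X) : NCRatExpr X

namespace NCRatExpr

variable {X : Type} {A : Type*} [Ring A] [Algebra ℂ A]

/-- The value of an expression at a tuple in a complex algebra; it is meaningful where
`IsDefinedAt` holds. -/
def eval (v : X → A) : NCRatExpr X → A
  | const c => algebraMap ℂ A c
  | var x => v x
  | add p q => eval v p + eval v q
  | mul p q => eval v p * eval v q
  | inv p => Ring.inverse (eval v p)

/-- The tuple lies in the domain of the expression: everything that has to be inverted is
invertible. -/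
def IsDefinedAt (v : X → A) : NCRatExpr X → Prop
  | const _ => True
  | var _ => True
  | add p q => IsDefinedAt v p ∧ IsDefinedAt v q
  | mul p q => IsDefinedAt v p ∧ IsDefinedAt v q
  | inv p => IsDefinedAt v p ∧ IsUnit (eval v p)

end NCRatExpr

/-- The letters `α_j, α_j^*, ρ_j^L, ρ_j^R` for `0 ≤ j < m`. -/
inductive VerblunskyLetter (m : ℕ) : Type
  | alpha (j : Fin m) : VerblunskyLetter m
  | alphaStar (j : Fin m) : VerblunskyLetter m
  | rhoL (j : Fin m) : VerblunskyLetter m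
  | rhoR (j : Fin m) : VerblunskyLetter m

/-- The matrices that the letters stand for, given the sequence `α`. -/
def letterValue (α : ℕ → Matrix (Fin d) (Fin d) ℂ) {m : ℕ} :
    VerblunskyLetter m → Matrix (Fin d) (Fin d) ℂ
  | .alpha j => α j
  | .alphaStar j => (α j)ᴴ
  | .rhoL j => rhoL (α j)
  | .rhoR j => rhoR (α j)

/-- `ρ_0^R ρ_1^R ⋯ ρ_{m-1}^R`. -/
def prodRhoR (α : ℕ → Matrix (Fin d) (Fin d) ℂ) (m : ℕ) : Matrix (Fin d) (Fin d) ℂ :=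
  ((List.range m).map fun j => rhoR (α j)).prod

/-- `ρ_{m-1}^L ⋯ ρ_1^L ρ_0^L`. -/
def prodRhoL (α : ℕ → Matrix (Fin d) (Fin d) ℂ) (m : ℕ) : Matrix (Fin d) (Fin d) ℂ :=
  ((List.range m).reverse.map fun j => rhoL (α j)).prod

end MatrixOPUC

end

/-!
Write `f_j` for the Schur iterates and `α_j` for the Verblunsky coefficients of `M`.

The formula for the moments comes from the Taylor coefficients `f_{j,k}` of the `f_j` at the origin.
The Schur step, solved for `f_j`, is
`f_j - α_j = z ρ_j^R f_{j+1} (ρ_j^L)⁻¹ (1 - α_j^* f_j)`, and comparing coefficients gives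
`f_{j,k+1} = ρ_j^R f_{j+1,k} ρ_j^L - ∑_{i < k} ρ_j^R f_{j+1,i} (ρ_j^L)⁻¹ α_j^* f_{j,k-i}`
(`coeff_succ_schurSeries`). By induction `f_{j,k}` equals
`ρ_j^R ⋯ ρ_{j+k-1}^R α_{j+k} ρ_{j+k-1}^L ⋯ ρ_j^L` up to a rational expression in the letters of index
less than `j + k` (`isRational_coeff_schurSeries_sub`). The relation `z f (F + 1) = F - 1` gives
`C_{n+1} = f_{0,n} + ∑_{i < n} f_{0,i} C_{n-i}` (`moment_succ_eq`), which transfers the statement to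
the moments. "Rational" means here that one expression serves all `d` and `M` (`IsRational`).

This presupposes that every `α_j` is a strict contraction, so that the `ρ_j` are invertible and the
singularities of the iterates are removable. A power series `g` is therefore regarded as the family
of lower triangular block Toeplitz matrices built from its coefficients. Nontriviality of `M` says
that the block Toeplitz matrices of the moments are positive definite, i.e. that those of `F` have
positive definite real part (`hasPosRealPart_herglotzSeries`). The Cayley transform then yields
strict contractions for `f_0` (`HasPosRealPart.isStrictContraction`), and the Schur step preserves
this property (`IsStrictContraction.schurSeriesStep`).

Analysis enters only in identifying functions with power series: `HasExpansion` records a finite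
Taylor expansion at the origin, is stable under sums, products, inverses and division by `z`, and
holds for the Herglotz function since its kernel is a geometric series.
-/

namespace MatrixOPUC

/-! ### Defect matrices of strict contractions -/

section Defect

variable {d : ℕ} {α : Matrix (Fin d) (Fin d) ℂ}

/-- If `α` is a strict contraction, so is `α^*`. -/
theorem posDef_one_sub_mul_conjTranspose (h : (1 - αᴴ * α).PosDef) : (1 - α * αᴴ).PosDef := by
  have key : 1 - α * αᴴ = (1 - α * αᴴ)ᴴ * (1 - α * αᴴ) + α * (1 - αᴴ * α) * αᴴ := by
    simp only [Matrix.conjTranspose_sub, Matrix.conjTranspose_one, Matrix.conjTranspose_mul,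
      Matrix.conjTranspose_conjTranspose]
    noncomm_ring
  -- `key` gives semidefiniteness; invertibility comes from that of `1 - α^* α`
  have hpos : (1 - α * αᴴ).PosSemidef := by
    rw [key]
    exact (Matrix.posSemidef_conjTranspose_mul_self _).add
      (h.posSemidef.mul_mul_conjTranspose_same α)
  have hu : IsUnit (1 - α * αᴴ) := by
    obtain ⟨u, hu⟩ := h.isUnit
    have h1 : (1 - αᴴ * α) * (u⁻¹ : (Matrix (Fin d) (Fin d) ℂ)ˣ) = 1 := by rw [← hu]; simp
    rw [Matrix.isUnit_iff_isUnit_det]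
    refine Matrix.isUnit_det_of_right_inverse
      (B := 1 + α * (u⁻¹ : (Matrix (Fin d) (Fin d) ℂ)ˣ) * αᴴ) ?_
    calc (1 - α * αᴴ) * (1 + α * (u⁻¹ : (Matrix (Fin d) (Fin d) ℂ)ˣ) * αᴴ)
        = 1 - α * αᴴ + α * ((1 - αᴴ * α) * (u⁻¹ : (Matrix (Fin d) (Fin d) ℂ)ˣ)) * αᴴ := by
          noncomm_ring
      _ = 1 := by rw [h1]; noncomm_ring
  exact hpos.posDef_iff_isUnit.mpr hu

theorem rhoL_mul_self (h : (1 - αᴴ * α).PosDef) : rhoL α * rhoL α = 1 - αᴴ * α :=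
  CFC.sqrt_mul_sqrt_self _ h.posSemidef.nonneg

theorem rhoR_mul_self (h : (1 - αᴴ * α).PosDef) : rhoR α * rhoR α = 1 - α * αᴴ :=
  CFC.sqrt_mul_sqrt_self _ (posDef_one_sub_mul_conjTranspose h).posSemidef.nonneg

theorem isUnit_rhoL (h : (1 - αᴴ * α).PosDef) : IsUnit (rhoL α) :=
  (CFC.isUnit_sqrt_iff _ h.posSemidef.nonneg).mpr h.isUnit

theorem isUnit_rhoR (h : (1 - αᴴ * α).PosDef) : IsUnit (rhoR α) :=
  (CFC.isUnit_sqrt_iff _ (posDef_one_sub_mul_conjTranspose h).posSemidef.nonneg).mpr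
    (posDef_one_sub_mul_conjTranspose h).isUnit

theorem conjTranspose_rhoL (α : Matrix (Fin d) (Fin d) ℂ) : (rhoL α)ᴴ = rhoL α :=
  (Matrix.nonneg_iff_posSemidef.mp (CFC.sqrt_nonneg (1 - αᴴ * α))).isHermitian

theorem conjTranspose_rhoR (α : Matrix (Fin d) (Fin d) ℂ) : (rhoR α)ᴴ = rhoR α :=
  (Matrix.nonneg_iff_posSemidef.mp (CFC.sqrt_nonneg (1 - α * αᴴ))).isHermitian

theorem conjTranspose_mul_self_eq_of_mul_self {P Q u : Matrix (Fin d) (Fin d) ℂ}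
    (hP : IsUnit P) (hPh : Pᴴ = P) (hPQ : P * P = Q) : uᴴ * u = (P * u)ᴴ * (Q⁻¹ * (P * u)) := by
  have hdet := (Matrix.isUnit_iff_isUnit_det _).mp hP
  have h1 : P⁻¹ * P = 1 := Matrix.nonsing_inv_mul _ hdet
  have h2 : P * P⁻¹ = 1 := Matrix.mul_nonsing_inv _ hdet
  rw [← hPQ, Matrix.mul_inv_rev, Matrix.conjTranspose_mul, hPh]
  calc uᴴ * u = uᴴ * (P * P⁻¹) * ((P⁻¹ * P) * u) := by rw [h1, h2]; simp
    _ = _ := by noncomm_ring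

/-- The identity behind the fact that the Möbius transformation
`y ↦ (ρ^R)⁻¹ (y - α) (1 - α^* y)⁻¹ ρ^L` preserves contractions: if `ρ^L u = w - α^* y` and
`ρ^R x = y - α w`, then `u^* u - x^* x = w^* w - y^* y`. -/
theorem moebius_defect_identity (h : (1 - αᴴ * α).PosDef) {u x w y : Matrix (Fin d) (Fin d) ℂ}
    (hu : rhoL α * u = w - αᴴ * y) (hx : rhoR α * x = y - α * w) :
    uᴴ * u - xᴴ * x = wᴴ * w - yᴴ * y := by
  have e1 := conjTranspose_mul_self_eq_of_mul_self (u := u) (isUnit_rhoL h)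
    (conjTranspose_rhoL α) (rhoL_mul_self h)
  have e2 := conjTranspose_mul_self_eq_of_mul_self (u := x) (isUnit_rhoR h)
    (conjTranspose_rhoR α) (rhoR_mul_self h)
  rw [hu] at e1
  rw [hx] at e2
  set L := 1 - αᴴ * α with hL
  have hLunit : IsUnit L.det := (Matrix.isUnit_iff_isUnit_det _).mp h.isUnit
  have hLL : L * L⁻¹ = 1 := Matrix.mul_nonsing_inv _ hLunit
  have hLL' : L⁻¹ * L = 1 := Matrix.nonsing_inv_mul _ hLunit
  -- the inverse of `1 - α α^*` is eliminated in favour of that of `1 - α^* α`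
  have hRinv : (1 - α * αᴴ)⁻¹ = 1 + α * L⁻¹ * αᴴ := by
    refine Matrix.inv_eq_right_inv ?_
    calc (1 - α * αᴴ) * (1 + α * L⁻¹ * αᴴ) = (1 - α * αᴴ) + α * (L * L⁻¹) * αᴴ := by
          rw [hL]; noncomm_ring
      _ = 1 := by rw [hLL]; noncomm_ring
  have a1 : αᴴ * α = 1 - L := by rw [hL]; abel
  have a2 : αᴴ * α * L⁻¹ = L⁻¹ - 1 := by rw [a1, sub_mul, hLL, one_mul]
  have a3 : L⁻¹ * (αᴴ * α) = L⁻¹ - 1 := by rw [a1, mul_sub, hLL', mul_one]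
  have a4 : αᴴ * α * L⁻¹ * (αᴴ * α) = L⁻¹ - 1 - αᴴ * α := by rw [a2, sub_mul, a3, one_mul]
  rw [e1, e2, hRinv]
  simp only [Matrix.conjTranspose_sub, Matrix.conjTranspose_mul, Matrix.conjTranspose_conjTranspose]
  have E : (wᴴ - yᴴ * α) * (L⁻¹ * (w - αᴴ * y)) -
      (yᴴ - wᴴ * αᴴ) * ((1 + α * L⁻¹ * αᴴ) * (y - α * w)) =
      wᴴ * (L⁻¹ - αᴴ * α * L⁻¹ * (αᴴ * α) - αᴴ * α) * w
      - wᴴ * (L⁻¹ - 1 - αᴴ * α * L⁻¹) * αᴴ * y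
      - yᴴ * α * (L⁻¹ - 1 - L⁻¹ * (αᴴ * α)) * w
      - yᴴ * y := by
    noncomm_ring
  rw [E, a4, a2, a3]
  noncomm_ring

end Defect

/-! ### Power series acting as lower triangular block Toeplitz operators -/

section Series

open PowerSeries

variable {d : ℕ}

/-- The power series with the coefficients of `g` moved down by one: `(g - g_0) / X`. -/
noncomputable def shift {A : Type*} [Semiring A] (g : A⟦X⟧) : A⟦X⟧ :=
  PowerSeries.mk fun n => coeff (n + 1) g

@[simp]
theorem coeff_shift {A : Type*} [Semiring A] (g : A⟦X⟧) (n : ℕ) :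
    coeff n (shift g) = coeff (n + 1) g := by
  simp [shift]

theorem eq_C_add_X_mul_shift {A : Type*} [Ring A] (g : A⟦X⟧) :
    g = C (coeff 0 g) + X * shift g := by
  have := sub_const_eq_X_mul_shift g
  rw [coeff_zero_eq_constantCoeff_apply]
  exact (sub_eq_iff_eq_add'.mp this)

theorem coeff_mul_eq_zero_of_forall_lt {A : Type*} [Semiring A] (g : A⟦X⟧) {v : A⟦X⟧} {N : ℕ}
    (hv : ∀ k < N, coeff k v = 0) : ∀ k < N, coeff k (g * v) = 0 := by
  intro k hk
  rw [coeff_mul]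
  refine Finset.sum_eq_zero fun p hp => ?_
  rw [Finset.HasAntidiagonal.mem_antidiagonal] at hp
  rw [hv p.2 (by omega), mul_zero]

theorem coeff_mul_congr_of_forall_lt {A : Type*} [Semiring A] (g : A⟦X⟧) {u v : A⟦X⟧} {N : ℕ}
    (huv : ∀ k < N, coeff k u = coeff k v) : ∀ k < N, coeff k (g * u) = coeff k (g * v) := by
  intro k hk
  rw [coeff_mul, coeff_mul]
  refine Finset.sum_congr rfl fun p hp => ?_
  rw [Finset.HasAntidiagonal.mem_antidiagonal] at hp
  rw [huv p.2 (by omega)]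

/-- The inner product `∑_{k < N} Tr (u_k^* v_k)` of the truncations of two power series. -/
noncomputable def truncForm (N : ℕ) (u v : (Matrix (Fin d) (Fin d) ℂ)⟦X⟧) : ℂ :=
  ∑ k ∈ Finset.range N, ((coeff k u)ᴴ * coeff k v).trace

/-- Multiplication by `g` strictly decreases the truncated norms: all block Toeplitz matrices
built from the coefficients of `g` are strict contractions. -/
noncomputable def IsStrictContraction (g : (Matrix (Fin d) (Fin d) ℂ)⟦X⟧) : Prop :=
  ∀ (N : ℕ) (v : (Matrix (Fin d) (Fin d) ℂ)⟦X⟧), (∃ k < N, coeff k v ≠ 0) →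
    (truncForm N (g * v) (g * v)).re < (truncForm N v v).re

/-- All block Toeplitz matrices built from the coefficients of `g` have a positive definite
real part. -/
noncomputable def HasPosRealPart (g : (Matrix (Fin d) (Fin d) ℂ)⟦X⟧) : Prop :=
  ∀ (N : ℕ) (v : (Matrix (Fin d) (Fin d) ℂ)⟦X⟧), (∃ k < N, coeff k v ≠ 0) →
    0 < (truncForm N v (g * v)).re

/-- The polarisation identity `‖y + v‖² - ‖y - v‖² = 4 Re ⟨v, y⟩`. -/
theorem truncForm_add_sub (N : ℕ) (v y : (Matrix (Fin d) (Fin d) ℂ)⟦X⟧) :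
    (truncForm N (y + v) (y + v)).re - (truncForm N (y - v) (y - v)).re =
      4 * (truncForm N v y).re := by
  have hconj : (truncForm N y v).re = (truncForm N v y).re := by
    rw [truncForm, truncForm, Complex.re_sum, Complex.re_sum]
    refine Finset.sum_congr rfl fun k _ => ?_
    rw [← Complex.conj_re, ← Complex.star_def, ← Matrix.trace_conjTranspose,
      Matrix.conjTranspose_mul, Matrix.conjTranspose_conjTranspose]
  have : truncForm N (y + v) (y + v) - truncForm N (y - v) (y - v) =
      2 * truncForm N v y + 2 * truncForm N y v := by
    simp only [truncForm, map_add, map_sub, Matrix.conjTranspose_add, Matrix.conjTranspose_sub,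
      add_mul, mul_add, sub_mul, mul_sub, Matrix.trace_add, Matrix.trace_sub,
      Finset.sum_add_distrib, Finset.sum_sub_distrib]
    ring
  have h2 := congrArg Complex.re this
  simp only [Complex.sub_re, Complex.add_re, Complex.mul_re, Complex.re_ofNat, Complex.im_ofNat,
    hconj] at h2
  linarith

/-- The Cayley transform of a series with positive real part is a strict contraction. -/
theorem HasPosRealPart.isStrictContraction {g h : (Matrix (Fin d) (Fin d) ℂ)⟦X⟧}
    (hg : HasPosRealPart g) (hu : IsUnit (g + 1)) (hh : h * (g + 1) = g - 1) :
    IsStrictContraction h := by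
  rintro N u ⟨k, hk, huk⟩
  -- with `u = (g + 1) v` one has `h u = (g - 1) v`, so that `‖u‖² - ‖h u‖² = 4 Re ⟨v, g v⟩`
  obtain ⟨q, hq⟩ := hu
  obtain ⟨v, rfl⟩ : ∃ v, u = (g + 1) * v := ⟨↑q⁻¹ * u, by rw [← hq]; simp⟩
  have hv : ∃ k < N, coeff k v ≠ 0 := by
    by_contra! hcon
    exact huk (coeff_mul_eq_zero_of_forall_lt _ hcon k hk)
  have h1 := hg N v hv
  have h2 := truncForm_add_sub N v (g * v)
  rw [← mul_assoc, hh, add_mul, sub_mul, one_mul]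
  linarith

theorem truncForm_X_mul (N : ℕ) (v : (Matrix (Fin d) (Fin d) ℂ)⟦X⟧) :
    truncForm (N + 1) (X * v) (X * v) = truncForm N v v := by
  simp [truncForm, Finset.sum_range_succ', coeff_succ_X_mul]

/-- A form of the Schwarz lemma: a factor `X` can be removed from a strict contraction. -/
theorem IsStrictContraction.of_X_mul {g : (Matrix (Fin d) (Fin d) ℂ)⟦X⟧}
    (hg : IsStrictContraction (X * g)) : IsStrictContraction g := by
  rintro N v ⟨k, hk, hvk⟩
  -- cutting `v` off at degree `N` makes its truncated norms of orders `N` and `N + 1` equal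
  set w : (Matrix (Fin d) (Fin d) ℂ)⟦X⟧ := PowerSeries.mk fun n => if n < N then coeff n v else 0
    with hw
  have hwv : ∀ k < N, coeff k w = coeff k v := fun k hk => by simp [hw, hk]
  have h1 := hg (N + 1) w ⟨k, by omega, by rwa [hwv k hk]⟩
  rw [mul_assoc, truncForm_X_mul] at h1
  have h2 : truncForm (N + 1) w w = truncForm N v v := by
    rw [truncForm, Finset.sum_range_succ, truncForm]
    have : coeff N w = 0 := by simp [hw]
    rw [this]
    simp only [Matrix.mul_zero, Matrix.trace_zero, add_zero]
    exact Finset.sum_congr rfl fun k hk => by rw [hwv k (Finset.mem_range.mp hk)]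
  have h3 : truncForm N (g * w) (g * w) = truncForm N (g * v) (g * v) :=
    Finset.sum_congr rfl fun k hk => by
      rw [coeff_mul_congr_of_forall_lt g hwv k (Finset.mem_range.mp hk)]
  rwa [h2, h3] at h1

/-- The constant coefficient of a strict contraction is a strict contraction. -/
theorem IsStrictContraction.posDef {g : (Matrix (Fin d) (Fin d) ℂ)⟦X⟧}
    (hg : IsStrictContraction g) : (1 - (coeff 0 g)ᴴ * coeff 0 g).PosDef := by
  set α := coeff 0 g with hα
  have hH : (1 - αᴴ * α).IsHermitian := by
    simp [Matrix.IsHermitian, Matrix.conjTranspose_sub, Matrix.conjTranspose_mul]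
  refine Matrix.PosDef.of_dotProduct_mulVec_pos hH fun x hx => ?_
  obtain ⟨i, hi⟩ := Function.ne_iff.mp hx
  -- a matrix whose columns all equal `x` stands in for the vector `x`
  set V : Matrix (Fin d) (Fin d) ℂ := Matrix.of fun j _ => x j with hV
  have h1 := hg 1 (C V) ⟨0, one_pos, by
    intro h0
    apply hi
    have := congrFun (congrFun h0 i) i
    simpa [hV] using this⟩
  have tr : ∀ B : Matrix (Fin d) (Fin d) ℂ, (Vᴴ * B * V).trace = d * (star x ⬝ᵥ (B *ᵥ x)) := by
    intro B
    have : ∀ j, (Vᴴ * B * V) j j = star x ⬝ᵥ (B *ᵥ x) := by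
      intro j
      rw [Matrix.mul_assoc]
      simp [Matrix.mul_apply, dotProduct, Matrix.mulVec, hV]
    simp [Matrix.trace, this]
  have h2 : truncForm 1 (C V) (C V) - truncForm 1 (g * C V) (g * C V) =
      d * (star x ⬝ᵥ ((1 - αᴴ * α) *ᵥ x)) := by
    rw [← tr]
    simp only [truncForm, Finset.range_one, Finset.sum_singleton, coeff_mul_C, ← hα,
      coeff_zero_C, ← Matrix.trace_sub, Matrix.conjTranspose_mul]
    congr 1
    noncomm_ring
  have h3 := congrArg Complex.re h2
  rw [Complex.sub_re] at h3
  have h4 : 0 < ((d : ℂ) * (star x ⬝ᵥ ((1 - αᴴ * α) *ᵥ x))).re := by linarith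
  have him : (star x ⬝ᵥ ((1 - αᴴ * α) *ᵥ x)).im = 0 := hH.im_star_dotProduct_mulVec_self x
  rw [← Complex.ofReal_natCast, Complex.re_ofReal_mul] at h4
  rw [Complex.pos_iff]
  exact ⟨pos_of_mul_pos_right h4 (Nat.cast_nonneg d), him.symm⟩

/-- The Schur step on power series. `Ring.inverse` is the genuine inverse for strict contractions,
by `isUnit_one_sub_C_mul`. -/
noncomputable def schurSeriesStep (g : (Matrix (Fin d) (Fin d) ℂ)⟦X⟧) :
    (Matrix (Fin d) (Fin d) ℂ)⟦X⟧ :=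
  shift (C (rhoR (coeff 0 g))⁻¹ * (g - C (coeff 0 g)) *
    Ring.inverse (1 - C (coeff 0 g)ᴴ * g) * C (rhoL (coeff 0 g)))

theorem isUnit_one_sub_C_mul {g : (Matrix (Fin d) (Fin d) ℂ)⟦X⟧} (hg : IsStrictContraction g) :
    IsUnit (1 - C (coeff 0 g)ᴴ * g) := by
  rw [PowerSeries.isUnit_iff_constantCoeff]
  simpa using hg.posDef.isUnit

theorem X_mul_schurSeriesStep (g : (Matrix (Fin d) (Fin d) ℂ)⟦X⟧) :
    X * schurSeriesStep g = C (rhoR (coeff 0 g))⁻¹ * (g - C (coeff 0 g)) *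
      Ring.inverse (1 - C (coeff 0 g)ᴴ * g) * C (rhoL (coeff 0 g)) := by
  have := eq_C_add_X_mul_shift (C (rhoR (coeff 0 g))⁻¹ * (g - C (coeff 0 g)) *
      Ring.inverse (1 - C (coeff 0 g)ᴴ * g) * C (rhoL (coeff 0 g)))
  rw [schurSeriesStep]
  conv_rhs => rw [this]
  simp

/-- The Schur step solved for the original series. -/
theorem sub_C_eq_schurSeriesStep {g : (Matrix (Fin d) (Fin d) ℂ)⟦X⟧}
    (hg : IsStrictContraction g) :
    g - C (coeff 0 g) = X * (C (rhoR (coeff 0 g)) * schurSeriesStep g *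
      C (rhoL (coeff 0 g))⁻¹ * (1 - C (coeff 0 g)ᴴ * g)) := by
  have hR := (Matrix.isUnit_iff_isUnit_det _).mp (isUnit_rhoR hg.posDef)
  have hL := (Matrix.isUnit_iff_isUnit_det _).mp (isUnit_rhoL hg.posDef)
  set α := coeff 0 g
  have h1 : C (rhoR α) * C (rhoR α)⁻¹ = (1 : (Matrix (Fin d) (Fin d) ℂ)⟦X⟧) := by
    rw [← map_mul, Matrix.mul_nonsing_inv _ hR, map_one]
  have h2 : C (rhoL α) * C (rhoL α)⁻¹ = (1 : (Matrix (Fin d) (Fin d) ℂ)⟦X⟧) := by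
    rw [← map_mul, Matrix.mul_nonsing_inv _ hL, map_one]
  have h3 := Ring.inverse_mul_cancel _ (isUnit_one_sub_C_mul hg)
  have hX : X * (C (rhoR α) * schurSeriesStep g * C (rhoL α)⁻¹ * (1 - C αᴴ * g)) =
      C (rhoR α) * (X * schurSeriesStep g) * C (rhoL α)⁻¹ * (1 - C αᴴ * g) := by
    simp only [← mul_assoc, ← (commute_X (C (rhoR α))).eq]
  rw [hX, X_mul_schurSeriesStep]
  calc g - C α = (C (rhoR α) * C (rhoR α)⁻¹) * (g - C α) *
        (Ring.inverse (1 - C αᴴ * g) * ((C (rhoL α) * C (rhoL α)⁻¹) * (1 - C αᴴ * g))) := by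
        rw [h2, one_mul, h3, h1]; simp
    _ = _ := by simp only [mul_assoc]; rfl

theorem IsStrictContraction.schurSeriesStep {g : (Matrix (Fin d) (Fin d) ℂ)⟦X⟧}
    (hg : IsStrictContraction g) : IsStrictContraction (schurSeriesStep g) := by
  refine IsStrictContraction.of_X_mul ?_
  rintro N u ⟨k, hk, huk⟩
  have hpos := hg.posDef
  have hR := (Matrix.isUnit_iff_isUnit_det _).mp (isUnit_rhoR hg.posDef)
  have hL := (Matrix.isUnit_iff_isUnit_det _).mp (isUnit_rhoL hg.posDef)
  have hunit := isUnit_one_sub_C_mul hg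
  rw [X_mul_schurSeriesStep]
  set α := coeff 0 g
  set w := Ring.inverse (1 - C αᴴ * g) * C (rhoL α) * u with hw
  -- the truncated norms of `u` and of its image `x` differ as those of `w` and `g w` do
  have hwu : C (rhoL α) * u = w - C αᴴ * (g * w) := by
    rw [← mul_assoc, ← one_sub_mul, hw, ← mul_assoc, ← mul_assoc,
      Ring.mul_inverse_cancel _ hunit, one_mul]
  have hu : u = C (rhoL α)⁻¹ * (1 - C αᴴ * g) * w := by
    rw [mul_assoc, one_sub_mul, mul_assoc, ← hwu, ← mul_assoc, ← map_mul,
      Matrix.nonsing_inv_mul _ hL, map_one, one_mul]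
  have hx : C (rhoR α) * (C (rhoR α)⁻¹ * (g - C α) * Ring.inverse (1 - C αᴴ * g) * C (rhoL α) * u)
      = g * w - C α * w := by
    simp only [← mul_assoc, ← map_mul]
    rw [Matrix.mul_nonsing_inv _ hR, map_one, one_mul, hw, ← sub_mul]
    simp only [mul_assoc]
  set x := C (rhoR α)⁻¹ * (g - C α) * Ring.inverse (1 - C αᴴ * g) * C (rhoL α) * u
  have hwne : ∃ k < N, coeff k w ≠ 0 := by
    by_contra! hcon
    rw [hu] at huk
    exact huk (coeff_mul_eq_zero_of_forall_lt _ hcon k hk)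
  have key : truncForm N u u - truncForm N x x = truncForm N w w - truncForm N (g * w) (g * w) := by
    simp only [truncForm, ← Finset.sum_sub_distrib, ← Matrix.trace_sub]
    refine Finset.sum_congr rfl fun k _ => ?_
    rw [moebius_defect_identity hpos (w := coeff k w) (y := coeff k (g * w))]
    · simpa using congrArg (coeff k) hwu
    · simpa using congrArg (coeff k) hx
  have h1 := hg N w hwne
  have h2 := congrArg Complex.re key
  simp only [Complex.sub_re] at h2
  linarith

end Series

/-! ### Taylor expansions at the origin -/

section Expansion

open PowerSeries

section General

variable {A : Type*} [Ring A] [Algebra ℂ A] [TopologicalSpace A]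

/-- `g` is the Taylor series of `f` at the origin up to order `N`: near the origin,
`f z = g_0 + z • g_1 + ⋯ + z ^ (N - 1) • g_{N - 1} + z ^ N • r z` with `r` continuous at `0`.
The definition splits off one coefficient at a time. -/
def HasExpansion : ℕ → (ℂ → A) → A⟦X⟧ → Prop
  | 0, f, _ => ContinuousAt f 0
  | N + 1, f, g => ∃ f' : ℂ → A, (∀ᶠ z in 𝓝 0, f z = coeff 0 g + z • f' z) ∧
      HasExpansion N f' (shift g)

namespace HasExpansion

variable {N : ℕ} {f f₁ f₂ : ℂ → A} {g g₁ g₂ : A⟦X⟧}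

theorem congr (h : HasExpansion N f₁ g) (hf : f₁ =ᶠ[𝓝 0] f₂) : HasExpansion N f₂ g := by
  cases N with
  | zero => exact ContinuousAt.congr h hf
  | succ N =>
    obtain ⟨f', h1, h2⟩ := h
    exact ⟨f', by filter_upwards [h1, hf] with z hz hz'; rw [← hz', hz], h2⟩

theorem apply_zero (h : HasExpansion (N + 1) f g) : f 0 = coeff 0 g := by
  obtain ⟨f', h1, -⟩ := h
  simpa using h1.self_of_nhds

theorem const (a : A) : HasExpansion N (fun _ => a) (C a) := by
  induction N generalizing a with
  | zero => exact continuousAt_const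
  | succ N ih =>
    refine ⟨fun _ => 0, by simp, ?_⟩
    have : shift (C a) = C (0 : A) := by ext n; simp
    rw [this]
    exact ih 0

theorem one : HasExpansion N (fun _ => (1 : A)) 1 := by
  simpa using const (N := N) (1 : A)

variable [IsTopologicalRing A]

theorem add (h₁ : HasExpansion N f₁ g₁) (h₂ : HasExpansion N f₂ g₂) :
    HasExpansion N (fun z => f₁ z + f₂ z) (g₁ + g₂) := by
  induction N generalizing f₁ f₂ g₁ g₂ with
  | zero => exact ContinuousAt.add h₁ h₂
  | succ N ih =>
    obtain ⟨f₁', e₁, h₁⟩ := h₁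
    obtain ⟨f₂', e₂, h₂⟩ := h₂
    refine ⟨fun z => f₁' z + f₂' z, ?_, ?_⟩
    · filter_upwards [e₁, e₂] with z hz₁ hz₂
      rw [hz₁, hz₂, map_add, smul_add]; abel
    · have : shift (g₁ + g₂) = shift g₁ + shift g₂ := by ext n; simp
      rw [this]
      exact ih h₁ h₂

variable [ContinuousSMul ℂ A]

theorem of_succ (h : HasExpansion (N + 1) f g) : HasExpansion N f g := by
  induction N generalizing f g with
  | zero =>
    obtain ⟨f', h1, h2⟩ := h
    have h2 : ContinuousAt f' 0 := h2
    refine ContinuousAt.congr (f := fun z => coeff 0 g + z • f' z) ?_ ?_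
    · exact continuousAt_const.add (continuousAt_id.smul h2)
    · filter_upwards [h1] with z hz using hz.symm
  | succ N ih =>
    obtain ⟨f', h1, h2⟩ := h
    exact ⟨f', h1, ih h2⟩

theorem continuousAt (h : HasExpansion N f g) : ContinuousAt f 0 := by
  induction N with
  | zero => exact h
  | succ N ih => exact ih h.of_succ

theorem mul (h₁ : HasExpansion N f₁ g₁) (h₂ : HasExpansion N f₂ g₂) :
    HasExpansion N (fun z => f₁ z * f₂ z) (g₁ * g₂) := by
  induction N generalizing f₁ f₂ g₁ g₂ with
  | zero => exact ContinuousAt.mul h₁ h₂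
  | succ N ih =>
    have h₂' := h₂.of_succ
    obtain ⟨f₁', e₁, h₁⟩ := h₁
    obtain ⟨f₂', e₂, h₂⟩ := h₂
    refine ⟨fun z => coeff 0 g₁ * f₂' z + f₁' z * f₂ z, ?_, ?_⟩
    · filter_upwards [e₁, e₂] with z hz₁ hz₂
      have : coeff 0 (g₁ * g₂) = coeff 0 g₁ * coeff 0 g₂ := by simp
      rw [this, hz₁, add_mul, smul_mul_assoc, smul_add, ← add_assoc]
      conv_lhs => rw [hz₂, mul_add, mul_smul_comm, ← hz₂]
    · have : shift (g₁ * g₂) = C (coeff 0 g₁) * shift g₂ + shift g₁ * g₂ := by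
        ext n
        rw [coeff_shift]
        conv_lhs => rw [eq_C_add_X_mul_shift g₁, add_mul, mul_assoc]
        rw [map_add, coeff_succ_X_mul, coeff_C_mul, map_add, coeff_C_mul, coeff_shift]
      rw [this]
      exact (ih (const _) h₂).add (ih h₁ h₂')

theorem neg (h : HasExpansion N f g) : HasExpansion N (fun z => -f z) (-g) := by
  have := (const (N := N) (-1 : A)).mul h
  simpa using this

theorem sub (h₁ : HasExpansion N f₁ g₁) (h₂ : HasExpansion N f₂ g₂) :
    HasExpansion N (fun z => f₁ z - f₂ z) (g₁ - g₂) := by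
  simpa only [sub_eq_add_neg] using h₁.add h₂.neg

/-- A two-sided inverse that is continuous at the origin is expanded by the inverse series. -/
theorem inv {f' : ℂ → A} {g' : A⟦X⟧} (h : HasExpansion N f g) (hc : ContinuousAt f' 0)
    (hf : ∀ᶠ z in 𝓝 0, f z * f' z = 1) (hg : g * g' = 1) (hg' : g' * g = 1) :
    HasExpansion N f' g' := by
  induction N with
  | zero => exact hc
  | succ N ih =>
    have hi := ih h.of_succ
    obtain ⟨r, e, hr⟩ := h
    have h0 : coeff 0 g' * coeff 0 g = 1 := by
      simpa using congrArg (coeff 0) hg'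
    refine ⟨fun z => -(coeff 0 g' * (r z * f' z)), ?_, ?_⟩
    · filter_upwards [e, hf] with z hz hz'
      have : coeff 0 g * f' z + z • (r z * f' z) = 1 := by
        rw [← smul_mul_assoc, ← add_mul, ← hz, hz']
      calc f' z = coeff 0 g' * (coeff 0 g * f' z) := by rw [← mul_assoc, h0, one_mul]
        _ = coeff 0 g' * (1 - z • (r z * f' z)) := by rw [← this]; simp
        _ = _ := by rw [mul_sub, mul_one, mul_smul_comm, smul_neg, sub_eq_add_neg]
    · have : shift g' = -(C (coeff 0 g') * (shift g * g')) := by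
        have h1 : C (coeff 0 g) * g' + X * (shift g * g') = 1 := by
          rw [← mul_assoc, ← add_mul, ← eq_C_add_X_mul_shift, hg]
        have h2 : g' = C (coeff 0 g') - X * (C (coeff 0 g') * (shift g * g')) := by
          calc g' = C (coeff 0 g') * (C (coeff 0 g) * g') := by
                rw [← mul_assoc, ← map_mul, h0, map_one, one_mul]
            _ = C (coeff 0 g') * (1 - X * (shift g * g')) := by rw [← h1]; simp
            _ = _ := by
              rw [mul_sub, mul_one, ← mul_assoc, ← mul_assoc, ← mul_assoc,
                (commute_X (C (coeff 0 g'))).eq]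
              simp only [mul_assoc]
        ext n
        rw [coeff_shift]
        conv_lhs => rw [h2]
        rw [map_sub, coeff_succ_X_mul, map_neg]
        simp
      rw [this]
      exact ((const _).mul (hr.mul hi)).neg

end HasExpansion

end General

variable {d : ℕ}

theorem continuousAt_matrix_inv {f : ℂ → Matrix (Fin d) (Fin d) ℂ} (hf : ContinuousAt f 0)
    (h0 : IsUnit (f 0)) : ContinuousAt (fun z => (f z)⁻¹) 0 := by
  have hdet : (f 0).det ≠ 0 := ((Matrix.isUnit_iff_isUnit_det _).mp h0).ne_zero
  have h1 : ContinuousAt (fun z => (f z).det) 0 :=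
    (Continuous.matrix_det continuous_id).continuousAt.comp hf
  have h2 : ContinuousAt (fun z => (f z).adjugate) 0 :=
    (Continuous.matrix_adjugate continuous_id).continuousAt.comp hf
  simp only [Matrix.inv_def, Ring.inverse_eq_inv']
  exact (h1.inv₀ hdet).smul h2

theorem eventually_isUnit_of_continuousAt {f : ℂ → Matrix (Fin d) (Fin d) ℂ}
    (hf : ContinuousAt f 0) (h0 : IsUnit (f 0)) : ∀ᶠ z in 𝓝 0, IsUnit (f z) := by
  have hdet : (f 0).det ≠ 0 := ((Matrix.isUnit_iff_isUnit_det _).mp h0).ne_zero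
  have h1 : ContinuousAt (fun z => (f z).det) 0 :=
    (Continuous.matrix_det continuous_id).continuousAt.comp hf
  filter_upwards [h1.eventually_ne hdet] with z hz
  exact (Matrix.isUnit_iff_isUnit_det _).mpr (isUnit_iff_ne_zero.mpr hz)

/-- `g` is the full Taylor series of `f` at the origin. -/
def HasTaylorSeries (f : ℂ → Matrix (Fin d) (Fin d) ℂ) (g : (Matrix (Fin d) (Fin d) ℂ)⟦X⟧) :
    Prop :=
  ∀ N, HasExpansion N f g

namespace HasTaylorSeries

variable {f : ℂ → Matrix (Fin d) (Fin d) ℂ} {g : (Matrix (Fin d) (Fin d) ℂ)⟦X⟧}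

theorem apply_zero (h : HasTaylorSeries f g) : f 0 = coeff 0 g :=
  HasExpansion.apply_zero (h 1)

theorem matrix_inv (h : HasTaylorSeries f g) (hg : IsUnit g) :
    HasTaylorSeries (fun z => (f z)⁻¹) (Ring.inverse g) := by
  have hc : ContinuousAt f 0 := h 0
  have h0 : IsUnit (f 0) := by
    rw [h.apply_zero, coeff_zero_eq_constantCoeff_apply]
    exact PowerSeries.isUnit_iff_constantCoeff.mp hg
  refine fun N => (h N).inv (continuousAt_matrix_inv hc h0) ?_ (Ring.mul_inverse_cancel _ hg)
    (Ring.inverse_mul_cancel _ hg)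
  filter_upwards [eventually_isUnit_of_continuousAt hc h0] with z hz
  exact Matrix.mul_nonsing_inv _ ((Matrix.isUnit_iff_isUnit_det _).mp hz)

/-- Removal of the singularity in `f z / z`. -/
theorem divZ (h : HasTaylorSeries f g) (h0 : coeff 0 g = 0) :
    HasTaylorSeries (divZ f) (shift g) := by
  intro N
  obtain ⟨f', e, hf'⟩ := h (N + 1)
  refine hf'.congr ?_
  rw [h0] at e
  simp only [zero_add] at e
  have e' : ∀ᶠ z in 𝓝[≠] 0, z⁻¹ • f z = f' z := by
    filter_upwards [e.filter_mono nhdsWithin_le_nhds, self_mem_nhdsWithin] with z hz hz0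
    rw [hz, smul_smul, inv_mul_cancel₀ hz0, one_smul]
  have hlim : limUnder (𝓝[≠] (0 : ℂ)) (fun z => z⁻¹ • f z) = f' 0 := by
    refine Tendsto.limUnder_eq ?_
    refine Tendsto.congr' (EventuallyEq.symm e') ?_
    exact hf'.continuousAt.tendsto.mono_left nhdsWithin_le_nhds
  rw [eventually_nhdsWithin_iff] at e'
  filter_upwards [e'] with z hz
  rcases eq_or_ne z 0 with rfl | hz0
  · rw [MatrixOPUC.divZ, Function.update_self, hlim]
  · rw [MatrixOPUC.divZ, Function.update_of_ne hz0, hz hz0]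

/-- The Schur step of functions is the Schur step of their Taylor series. -/
theorem schurStep (h : HasTaylorSeries f g) (hg : IsStrictContraction g) :
    HasTaylorSeries (schurStep f) (schurSeriesStep g) := by
  have h0 := h.apply_zero
  rw [MatrixOPUC.schurStep, h0]
  refine HasTaylorSeries.divZ (g := C (rhoR (coeff 0 g))⁻¹ * (g - C (coeff 0 g)) *
    Ring.inverse (1 - C (coeff 0 g)ᴴ * g) * C (rhoL (coeff 0 g))) ?_ (by simp)
  have h1 : HasTaylorSeries (fun z => 1 - (coeff 0 g)ᴴ * f z) (1 - C (coeff 0 g)ᴴ * g) :=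
    fun N => HasExpansion.one.sub ((HasExpansion.const _).mul (h N))
  have h2 := h1.matrix_inv (isUnit_one_sub_C_mul hg)
  exact fun N => (((HasExpansion.const _).mul ((h N).sub (HasExpansion.const _))).mul (h2 N)).mul
    (HasExpansion.const _)

end HasTaylorSeries

end Expansion

/-! ### Integration against complex measures on the circle -/

section Integral

theorem variation_complexMeasure_le (μ : ComplexMeasure Circle) :
    μ.variation ≤ (ComplexMeasure.re μ).variation + (ComplexMeasure.im μ).variation := by
  refine VectorMeasure.variation_le_of_forall_enorm_le fun s _ => ?_
  have h1 : ‖μ s‖ₑ ≤ ‖ComplexMeasure.re μ s‖ₑ + ‖ComplexMeasure.im μ s‖ₑ := by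
    rw [← ofReal_norm, ← ofReal_norm, ← ofReal_norm, ← ENNReal.ofReal_add (norm_nonneg _)
      (norm_nonneg _)]
    exact ENNReal.ofReal_le_ofReal (Complex.norm_le_abs_re_add_abs_im (μ s))
  exact h1.trans (add_le_add (VectorMeasure.enorm_measure_le_variation _ _)
    (VectorMeasure.enorm_measure_le_variation _ _))

/-- Complex measures have finite variation, so that bounded functions are integrable and the
integrals below are not the junk value `0`. -/
instance isFiniteMeasure_variation_complexMeasure (μ : ComplexMeasure Circle) :
    IsFiniteMeasure μ.variation := by
  have h : ∀ ν : SignedMeasure Circle, IsFiniteMeasure ν.variation := fun ν => by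
    rw [← SignedMeasure.totalVariation_eq_variation]
    infer_instance
  have h1 := h (ComplexMeasure.re μ)
  have h2 := h (ComplexMeasure.im μ)
  exact isFiniteMeasure_of_le _ (variation_complexMeasure_le μ)

variable {μ ν : ComplexMeasure Circle} {φ ψ : Circle → ℂ}

theorem integrable_of_continuous (μ : ComplexMeasure Circle) (hφ : Continuous φ) :
    μ.Integrable φ :=
  hφ.integrable_of_hasCompactSupport (HasCompactSupport.of_compactSpace φ)

theorem cintegral_add (hφ : Continuous φ) (hψ : Continuous ψ) :
    cintegral μ (fun ζ => φ ζ + ψ ζ) = cintegral μ φ + cintegral μ ψ :=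
  VectorMeasure.integral_fun_add (integrable_of_continuous μ hφ) (integrable_of_continuous μ hψ)

theorem cintegral_finsetSum {ι : Type*} (s : Finset ι) {φ : ι → Circle → ℂ}
    (hφ : ∀ i ∈ s, Continuous (φ i)) :
    cintegral μ (fun ζ => ∑ i ∈ s, φ i ζ) = ∑ i ∈ s, cintegral μ (φ i) :=
  VectorMeasure.integral_finsetSum s fun i hi => integrable_of_continuous μ (hφ i hi)

theorem cintegral_const_mul (c : ℂ) (φ : Circle → ℂ) :
    cintegral μ (fun ζ => c * φ ζ) = c * cintegral μ φ :=
  setToFun_smul (𝕜 := ℂ) (dominatedFinMeasAdditive_cbmApplyMeasure μ _)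
    (fun c s x => by
      change c * x * μ s = c * (x * μ s)
      ring) c φ

theorem cintegral_one : cintegral μ (fun _ => 1) = μ Set.univ := by
  rw [cintegral, VectorMeasure.integral_const]
  simp

/-- Conjugating both the measure and the function conjugates the integral. -/
theorem cintegral_conj (hμν : ∀ s, ν s = star (μ s)) (hφ : Continuous φ) :
    cintegral ν (fun ζ => star (φ ζ)) = star (cintegral μ φ) := by
  have hstar : ∀ z : ℂ, ‖star z‖ₑ = ‖z‖ₑ := fun z => by rw [← ofReal_norm, norm_star, ofReal_norm]
  have hv : ν.variation = μ.variation := by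
    refine le_antisymm ?_ ?_ <;>
      refine VectorMeasure.variation_le_of_forall_enorm_le fun s _ => ?_
    · rw [hμν, hstar]; exact VectorMeasure.enorm_measure_le_variation _ _
    · rw [← hstar, ← hμν]; exact VectorMeasure.enorm_measure_le_variation _ _
  have e1 := VectorMeasure.continuousLinearMap_apply_integral
    (B := ContinuousLinearMap.mul ℝ ℂ) (C := (Complex.conjCLE : ℂ →L[ℝ] ℂ))
    (integrable_of_continuous μ hφ)
  have e2 := VectorMeasure.integral_continuousLinearMap_comp
    (B := ContinuousLinearMap.mul ℝ ℂ) (C := (Complex.conjCLE : ℂ →L[ℝ] ℂ))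
    (integrable_of_continuous ν hφ)
  refine e2.trans (Eq.trans ?_ e1.symm)
  have ht : ν.transpose (ContinuousLinearMap.mul ℝ ℂ ∘L (Complex.conjCLE : ℂ →L[ℝ] ℂ)) =
      μ.transpose (ContinuousLinearMap.compL ℝ ℂ ℂ ℂ (Complex.conjCLE : ℂ →L[ℝ] ℂ) ∘L
        ContinuousLinearMap.mul ℝ ℂ) := by
    ext s hs : 1
    ext x
    change star x * ν s = star (x * μ s)
    rw [hμν, star_mul']
  rw [VectorMeasure.integral_eq_setToFun, VectorMeasure.integral_eq_setToFun]
  simp only [hv, ht]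
  exact setToFun_congr_left _ _ rfl φ

end Integral

/-! ### Moments and the Herglotz function -/

section Moments

open PowerSeries

variable {d : ℕ} {M : MatrixMeasure d}

theorem continuous_circle_coe : Continuous fun ζ : Circle => (ζ : ℂ) :=
  continuous_subtype_val

theorem continuous_circle_zpow (n : ℤ) : Continuous fun ζ : Circle => (ζ : ℂ) ^ n :=
  continuous_circle_coe.zpow₀ n fun ζ => Or.inl ζ.coe_ne_zero

theorem scalarIntegral_add {φ ψ : Circle → ℂ} (hφ : Continuous φ) (hψ : Continuous ψ) :
    scalarIntegral M (fun ζ => φ ζ + ψ ζ) = scalarIntegral M φ + scalarIntegral M ψ := by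
  ext i j
  exact cintegral_add hφ hψ

theorem scalarIntegral_const_mul (c : ℂ) (φ : Circle → ℂ) :
    scalarIntegral M (fun ζ => c * φ ζ) = c • scalarIntegral M φ := by
  ext i j
  exact cintegral_const_mul c φ

theorem scalarIntegral_one (hM : IsNormalized M) : scalarIntegral M (fun _ => 1) = 1 := by
  rw [← hM]
  ext i j
  exact cintegral_one

theorem moment_zero (hM : IsNormalized M) : moment M 0 = 1 := by
  rw [← scalarIntegral_one hM]
  simp [moment]

/-- The moments of a positive measure satisfy `C_{-n} = C_n^*`. -/
theorem moment_neg (hM : IsPositive M) (n : ℤ) : moment M (-n) = (moment M n)ᴴ := by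
  ext i j
  -- a vector measure vanishes on non-measurable sets, so the symmetry holds for all sets
  have hent : ∀ s, entry M i j s = star (entry M j i s) := by
    intro s
    change M s i j = star (M s j i)
    by_cases hs : MeasurableSet s
    · exact ((hM s hs).isHermitian.apply i j).symm
    · simp [VectorMeasure.not_measurable _ hs]
  have := cintegral_conj hent (continuous_circle_zpow (-n))
  rw [Matrix.conjTranspose_apply]
  refine Eq.trans ?_ this
  change cintegral (entry M i j) (fun ζ => (ζ : ℂ) ^ (- -n)) = _
  congr 1
  funext ζ
  rw [star_zpow₀, Complex.star_def, ← Circle.coe_inv_eq_conj, Circle.coe_inv, inv_zpow, zpow_neg]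

/-- The power series `1 + 2 ∑_{n ≥ 1} C_n X^n`. -/
noncomputable def herglotzSeries (M : MatrixMeasure d) : (Matrix (Fin d) (Fin d) ℂ)⟦X⟧ :=
  1 + X * PowerSeries.mk fun n => (2 : ℂ) • moment M (n + 1 : ℕ)

/-- The integral `∫ 2 ζ^{-n} ζ / (ζ - z) dM(ζ)`, which is `2 ∑_{k ≥ 0} C_{n + k} z^k`. -/
noncomputable def herglotzRemainder (M : MatrixMeasure d) (n : ℕ) (z : ℂ) :
    Matrix (Fin d) (Fin d) ℂ :=
  scalarIntegral M fun ζ => 2 * (ζ : ℂ) ^ (-(n : ℤ)) * ((ζ : ℂ) / ((ζ : ℂ) - z))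

theorem circle_sub_ne_zero (ζ : Circle) {z : ℂ} (hz : ‖z‖ < 1) : (ζ : ℂ) - z ≠ 0 := by
  intro h
  rw [sub_eq_zero] at h
  rw [← h, Circle.norm_coe] at hz
  exact lt_irrefl _ hz

theorem continuous_herglotzRemainder_integrand (n : ℕ) {z : ℂ} (hz : ‖z‖ < 1) :
    Continuous fun ζ : Circle => 2 * (ζ : ℂ) ^ (-(n : ℤ)) * ((ζ : ℂ) / ((ζ : ℂ) - z)) :=
  (continuous_const.mul (continuous_circle_zpow _)).mul
    (continuous_circle_coe.div (continuous_circle_coe.sub continuous_const)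
      fun ζ => circle_sub_ne_zero ζ hz)

theorem eventually_norm_lt_half : ∀ᶠ z : ℂ in 𝓝 0, ‖z‖ < 1 / 2 := by
  have := Metric.ball_mem_nhds (0 : ℂ) (one_half_pos (α := ℝ))
  filter_upwards [this] with z hz
  simpa using hz

theorem continuousAt_herglotzRemainder (n : ℕ) : ContinuousAt (herglotzRemainder M n) 0 := by
  refine continuousAt_pi.mpr fun i => continuousAt_pi.mpr fun j => ?_
  refine VectorMeasure.continuousAt_of_dominated (bound := fun _ => 4) ?_ ?_
    (integrable_const _) ?_
  · filter_upwards [eventually_norm_lt_half] with z hz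
    exact (integrable_of_continuous _
      (continuous_herglotzRemainder_integrand n (by linarith))).aestronglyMeasurable
  · filter_upwards [eventually_norm_lt_half] with z hz
    refine ae_of_all _ fun ζ => ?_
    have h1 : 1 / 2 ≤ ‖(ζ : ℂ) - z‖ := by
      have := norm_sub_norm_le (ζ : ℂ) z
      rw [Circle.norm_coe] at this
      linarith
    rw [norm_mul, norm_mul, norm_zpow, norm_div, Circle.norm_coe, one_zpow, RCLike.norm_ofNat,
      mul_one, mul_one_div, div_le_iff₀ (by linarith)]
    linarith
  · refine ae_of_all _ fun ζ => ?_
    refine continuousAt_const.mul (continuousAt_const.div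
      (continuousAt_const.sub continuousAt_id) ?_)
    simp

/-- Splitting off one term of the geometric series in the kernel. -/
theorem herglotzRemainder_eq (n : ℕ) {z : ℂ} (hz : ‖z‖ < 1) :
    herglotzRemainder M n z = (2 : ℂ) • moment M n + z • herglotzRemainder M (n + 1) z := by
  rw [moment, herglotzRemainder, herglotzRemainder, ← scalarIntegral_const_mul,
    ← scalarIntegral_const_mul, ← scalarIntegral_add
      (φ := fun ζ => 2 * (ζ : ℂ) ^ (-(n : ℤ)))
      (ψ := fun ζ => z * (2 * (ζ : ℂ) ^ (-((n + 1 : ℕ) : ℤ)) * ((ζ : ℂ) / ((ζ : ℂ) - z))))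
      (continuous_const.mul (continuous_circle_zpow _))
      (continuous_const.mul (continuous_herglotzRemainder_integrand _ hz))]
  congr 1
  funext ζ
  have h1 := circle_sub_ne_zero ζ hz
  have h2 := ζ.coe_ne_zero
  have h3 : (ζ : ℂ) ^ (-((n + 1 : ℕ) : ℤ)) = (ζ : ℂ) ^ (-(n : ℤ)) * (ζ : ℂ)⁻¹ := by
    rw [← zpow_sub_one₀ h2]; congr 1; push_cast; ring
  rw [h3]
  field_simp
  ring

theorem herglotz_eq (hM : IsNormalized M) {z : ℂ} (hz : ‖z‖ < 1) :
    herglotz M z = 1 + z • herglotzRemainder M 1 z := by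
  rw [← scalarIntegral_one hM, herglotz, herglotzRemainder, ← scalarIntegral_const_mul,
    ← scalarIntegral_add (φ := fun _ => 1)
      (ψ := fun ζ => z * (2 * (ζ : ℂ) ^ (-((1 : ℕ) : ℤ)) * ((ζ : ℂ) / ((ζ : ℂ) - z))))
      continuous_const
      (continuous_const.mul (continuous_herglotzRemainder_integrand _ hz))]
  congr 1
  funext ζ
  have h1 := circle_sub_ne_zero ζ hz
  have h2 := ζ.coe_ne_zero
  rw [Nat.cast_one, zpow_neg_one]
  field_simp
  ring

theorem hasExpansion_herglotzRemainder (N n : ℕ) :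
    HasExpansion N (herglotzRemainder M n)
      (PowerSeries.mk fun k => (2 : ℂ) • moment M (n + k : ℕ)) := by
  induction N generalizing n with
  | zero => exact continuousAt_herglotzRemainder n
  | succ N ih =>
    refine ⟨herglotzRemainder M (n + 1), ?_, ?_⟩
    · filter_upwards [eventually_norm_lt_half] with z hz
      rw [herglotzRemainder_eq n (by linarith)]
      simp
    · convert ih (n + 1) using 1
      ext1 k
      rw [coeff_shift, coeff_mk, coeff_mk, add_right_comm, add_assoc]

theorem hasTaylorSeries_herglotz (hM : IsNormalized M) :
    HasTaylorSeries (herglotz M) (herglotzSeries M) := by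
  intro N
  refine HasExpansion.of_succ ⟨herglotzRemainder M 1, ?_, ?_⟩
  · filter_upwards [eventually_norm_lt_half] with z hz
    rw [herglotz_eq hM (by linarith)]
    simp [herglotzSeries]
  · convert hasExpansion_herglotzRemainder N 1 using 1
    ext1 k
    rw [coeff_shift, herglotzSeries, map_add, coeff_succ_X_mul, coeff_mk, coeff_mk, add_comm 1 k]
    simp [coeff_one]

/-! ### Nontriviality and positivity of the block Toeplitz matrices of moments -/

theorem sum_rotate {ι κ l R : Type*} [AddCommMonoid R] (s : Finset ι) (t : Finset κ) (u : Finset l)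
    (f : ι → κ → l → R) :
    ∑ i ∈ s, ∑ j ∈ t, ∑ k ∈ u, f i j k = ∑ j ∈ t, ∑ k ∈ u, ∑ i ∈ s, f i j k := by
  rw [Finset.sum_comm]
  exact Finset.sum_congr rfl fun _ _ => Finset.sum_comm

theorem polyEval_trunc (N : ℕ) (v : (Matrix (Fin d) (Fin d) ℂ)⟦X⟧) (ζ : Circle) :
    polyEval (trunc N v) ζ = ∑ k ∈ Finset.range N, (ζ : ℂ) ^ k • coeff k v := by
  cases N with
  | zero =>
    have : trunc 0 v = 0 := by ext1 n; simp
    simp [polyEval, this]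
  | succ N =>
    rw [polyEval, Polynomial.sum_over_range' _ (fun n => by simp) (N + 1) (natDegree_trunc_lt v N)]
    refine Finset.sum_congr rfl fun k hk => ?_
    rw [coeff_trunc, if_pos (Finset.mem_range.mp hk)]

/-- `Tr ∫ P^* dM P` in terms of the moments. -/
theorem trace_sandwichIntegral_trunc (N : ℕ) (v : (Matrix (Fin d) (Fin d) ℂ)⟦X⟧) :
    (sandwichIntegral M (fun ζ => (polyEval (trunc N v) ζ)ᴴ)
      (fun ζ => polyEval (trunc N v) ζ)).trace =
    ∑ k ∈ Finset.range N, ∑ l ∈ Finset.range N,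
      ((coeff k v)ᴴ * moment M ((k : ℤ) - l) * coeff l v).trace := by
  have h1 : ∀ i j j' : Fin d, cintegral (entry M j j') (fun ζ =>
      (polyEval (trunc N v) ζ)ᴴ i j * polyEval (trunc N v) ζ j' i) =
      ∑ k ∈ Finset.range N, ∑ l ∈ Finset.range N,
        (star (coeff k v j i) * moment M ((k : ℤ) - l) j j' * coeff l v j' i) := by
    intro i j j'
    have e : ∀ ζ : Circle, (polyEval (trunc N v) ζ)ᴴ i j * polyEval (trunc N v) ζ j' i =
        ∑ k ∈ Finset.range N, ∑ l ∈ Finset.range N,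
          (star (coeff k v j i) * coeff l v j' i) * (ζ : ℂ) ^ (-((k : ℤ) - l)) := by
      intro ζ
      rw [polyEval_trunc, Matrix.conjTranspose_apply, Matrix.sum_apply, Matrix.sum_apply, star_sum,
        Finset.sum_mul_sum]
      refine Finset.sum_congr rfl fun k _ => Finset.sum_congr rfl fun l _ => ?_
      have h2 : (ζ : ℂ) ^ (-((k : ℤ) - l)) = ((ζ : ℂ)⁻¹) ^ k * (ζ : ℂ) ^ l := by
        rw [neg_sub, sub_eq_add_neg, add_comm, zpow_add₀ ζ.coe_ne_zero, zpow_neg, zpow_natCast,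
          zpow_natCast, inv_pow]
      rw [h2, Matrix.smul_apply, Matrix.smul_apply, smul_eq_mul, smul_eq_mul, star_mul', star_pow,
        Complex.star_def, ← Circle.coe_inv_eq_conj, Circle.coe_inv]
      ring
    simp only [e]
    have hc : ∀ k l : ℕ, Continuous fun ζ : Circle =>
        (star (coeff k v j i) * coeff l v j' i) * (ζ : ℂ) ^ (-((k : ℤ) - l)) :=
      fun k l => continuous_const.mul (continuous_circle_zpow _)
    rw [cintegral_finsetSum _ fun k _ => continuous_finsetSum _ fun l _ => hc k l]
    refine Finset.sum_congr rfl fun k _ => ?_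
    rw [cintegral_finsetSum _ fun l _ => hc k l]
    refine Finset.sum_congr rfl fun l _ => ?_
    rw [cintegral_const_mul]
    change _ * moment M ((k : ℤ) - l) j j' = _
    ring
  simp only [Matrix.trace, Matrix.diag, sandwichIntegral, Matrix.of_apply]
  simp only [h1]
  simp only [Matrix.mul_apply, Matrix.conjTranspose_apply, Finset.sum_mul]
  refine Eq.trans ?_ (sum_rotate Finset.univ (Finset.range N) (Finset.range N) _)
  refine Finset.sum_congr rfl fun i _ => ?_
  rw [Finset.sum_comm]
  refine Eq.trans ?_ (sum_rotate Finset.univ (Finset.range N) (Finset.range N) _)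
  exact Finset.sum_congr rfl fun j _ => sum_rotate _ _ _ _

theorem truncForm_succ_herglotzSeries (N : ℕ) (v : (Matrix (Fin d) (Fin d) ℂ)⟦X⟧) :
    truncForm (N + 1) v (herglotzSeries M * v) = truncForm N v (herglotzSeries M * v) +
      (2 * ∑ l ∈ Finset.range N, ((coeff N v)ᴴ * moment M ((N : ℤ) - l) * coeff l v).trace +
        ((coeff N v)ᴴ * coeff N v).trace) := by
  rw [truncForm, Finset.sum_range_succ, ← truncForm]
  congr 1
  have h : coeff N (herglotzSeries M * v) =
      2 * ∑ l ∈ Finset.range N, moment M ((N : ℤ) - l) * coeff l v + coeff N v := by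
    rw [herglotzSeries, add_mul, one_mul, map_add, add_comm, mul_assoc]
    congr 1
    cases N with
    | zero => simp
    | succ N =>
      rw [coeff_succ_X_mul, coeff_mul, Finset.Nat.sum_antidiagonal_eq_sum_range_succ_mk,
        ← Finset.sum_range_reflect, Finset.mul_sum]
      refine Finset.sum_congr rfl fun l hl => ?_
      have hl' : l ≤ N := by rw [Finset.mem_range] at hl; omega
      have e1 : N - (N + 1 - 1 - l) = l := by omega
      have e2 : ((N + 1 - 1 - l + 1 : ℕ) : ℤ) = ((N + 1 : ℕ) : ℤ) - l := by omega
      rw [coeff_mk, e1, e2, smul_mul_assoc, two_smul, two_mul]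
  rw [h, mul_add, Matrix.trace_add, two_mul, two_mul, mul_add, Matrix.trace_add, Finset.mul_sum,
    Matrix.trace_sum]
  simp only [mul_assoc]

/-- For a positive normalised measure, the real part of the block Toeplitz matrix of the Herglotz
function is the block Toeplitz matrix of the moments. -/
theorem re_truncForm_herglotzSeries (hM : IsPositive M) (hM' : IsNormalized M) (N : ℕ)
    (v : (Matrix (Fin d) (Fin d) ℂ)⟦X⟧) :
    (truncForm N v (herglotzSeries M * v)).re =
      (∑ k ∈ Finset.range N, ∑ l ∈ Finset.range N,
        ((coeff k v)ᴴ * moment M ((k : ℤ) - l) * coeff l v).trace).re := by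
  have hsymm : ∀ k l : ℕ, (((coeff k v)ᴴ * moment M ((k : ℤ) - l) * coeff l v).trace).re =
      (((coeff l v)ᴴ * moment M ((l : ℤ) - k) * coeff k v).trace).re := by
    intro k l
    rw [← neg_sub (k : ℤ) l, moment_neg hM, ← Complex.conj_re, ← Complex.star_def,
      ← Matrix.trace_conjTranspose]
    simp only [Matrix.conjTranspose_mul, Matrix.conjTranspose_conjTranspose, Matrix.mul_assoc]
  induction N with
  | zero => simp [truncForm]
  | succ N ih =>
    rw [truncForm_succ_herglotzSeries, Finset.sum_range_succ, Finset.sum_range_succ]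
    simp only [Finset.sum_range_succ, Finset.sum_add_distrib]
    have h0 : moment M ((N : ℤ) - N) = 1 := by rw [sub_self, moment_zero hM']
    rw [h0, mul_one, Complex.add_re, Complex.add_re, Complex.add_re, Complex.add_re,
      Complex.add_re, ih, two_mul, Complex.add_re]
    have h1 : (∑ l ∈ Finset.range N,
        ((coeff N v)ᴴ * moment M ((N : ℤ) - l) * coeff l v).trace).re =
        (∑ l ∈ Finset.range N,
        ((coeff l v)ᴴ * moment M ((l : ℤ) - N) * coeff N v).trace).re := by
      rw [Complex.re_sum, Complex.re_sum]
      exact Finset.sum_congr rfl fun l _ => hsymm N l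
    linarith

theorem hasPosRealPart_herglotzSeries (hM : IsPositive M) (hM' : IsNormalized M)
    (hM'' : IsNontrivial M) : HasPosRealPart (herglotzSeries M) := by
  rintro N v ⟨k, hk, hv⟩
  rw [re_truncForm_herglotzSeries hM hM', ← trace_sandwichIntegral_trunc]
  refine Real.sqrt_pos.mp (hM'' (trunc N v) ?_).2
  intro h
  have := congrArg (fun P => Polynomial.coeff P k) h
  rw [coeff_trunc, if_pos hk] at this
  exact hv this

end Moments

/-! ### The formal Schur algorithm -/

section SchurSeries

open PowerSeries

variable {d : ℕ} {M : MatrixMeasure d}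

/-- The Taylor series of the Schur iterates of `M`, computed by the formal Schur algorithm. -/
noncomputable def schurSeries (M : MatrixMeasure d) (n : ℕ) : (Matrix (Fin d) (Fin d) ℂ)⟦X⟧ :=
  schurSeriesStep^[n] (shift ((herglotzSeries M - 1) * Ring.inverse (herglotzSeries M + 1)))

theorem schurSeries_succ (M : MatrixMeasure d) (n : ℕ) :
    schurSeries M (n + 1) = schurSeriesStep (schurSeries M n) :=
  Function.iterate_succ_apply' _ _ _

theorem coeff_zero_herglotzSeries (M : MatrixMeasure d) : coeff 0 (herglotzSeries M) = 1 := by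
  simp [herglotzSeries]

theorem isUnit_herglotzSeries_add_one (M : MatrixMeasure d) : IsUnit (herglotzSeries M + 1) := by
  rw [PowerSeries.isUnit_iff_constantCoeff, ← coeff_zero_eq_constantCoeff_apply, map_add,
    coeff_zero_herglotzSeries, coeff_zero_one, one_add_one_eq_two]
  have : IsUnit (algebraMap ℂ (Matrix (Fin d) (Fin d) ℂ) 2) :=
    (isUnit_iff_ne_zero.mpr two_ne_zero).map _
  rwa [map_ofNat] at this

theorem X_mul_schurSeries_zero (M : MatrixMeasure d) :
    X * schurSeries M 0 = (herglotzSeries M - 1) * Ring.inverse (herglotzSeries M + 1) := by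
  have := eq_C_add_X_mul_shift ((herglotzSeries M - 1) * Ring.inverse (herglotzSeries M + 1))
  conv_rhs => rw [this]
  have h0 : coeff 0 ((herglotzSeries M - 1) * Ring.inverse (herglotzSeries M + 1)) = 0 := by
    simp [coeff_zero_eq_constantCoeff_apply, herglotzSeries]
  rw [h0, map_zero, zero_add]
  rfl

theorem X_mul_schurSeries_zero_mul (M : MatrixMeasure d) :
    X * schurSeries M 0 * (herglotzSeries M + 1) = herglotzSeries M - 1 := by
  rw [X_mul_schurSeries_zero, mul_assoc,
    Ring.inverse_mul_cancel _ (isUnit_herglotzSeries_add_one M), mul_one]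

theorem isStrictContraction_schurSeries (hM : IsPositive M) (hM' : IsNormalized M)
    (hM'' : IsNontrivial M) (n : ℕ) : IsStrictContraction (schurSeries M n) := by
  induction n with
  | zero =>
    exact ((hasPosRealPart_herglotzSeries hM hM' hM'').isStrictContraction
      (isUnit_herglotzSeries_add_one M) (X_mul_schurSeries_zero_mul M)).of_X_mul
  | succ n ih =>
    rw [schurSeries_succ]
    exact ih.schurSeriesStep

theorem hasTaylorSeries_schurIterate (hM : IsPositive M) (hM' : IsNormalized M)
    (hM'' : IsNontrivial M) (n : ℕ) : HasTaylorSeries (schurIterate M n) (schurSeries M n) := by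
  induction n with
  | zero =>
    have hF := hasTaylorSeries_herglotz hM'
    have h1 : HasTaylorSeries (fun z => herglotz M z + 1) (herglotzSeries M + 1) :=
      fun N => (hF N).add HasExpansion.one
    have h2 := h1.matrix_inv (isUnit_herglotzSeries_add_one M)
    refine HasTaylorSeries.divZ (g := (herglotzSeries M - 1) * Ring.inverse (herglotzSeries M + 1))
      (fun N => ((hF N).sub HasExpansion.one).mul (h2 N)) ?_
    simp [coeff_zero_eq_constantCoeff_apply, herglotzSeries]
  | succ n ih =>
    rw [schurSeries_succ, schurIterate, Function.iterate_succ_apply']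
    exact HasTaylorSeries.schurStep ih (isStrictContraction_schurSeries hM hM' hM'' n)

theorem verblunsky_eq_coeff (hM : IsPositive M) (hM' : IsNormalized M) (hM'' : IsNontrivial M)
    (n : ℕ) : verblunsky M n = coeff 0 (schurSeries M n) :=
  (hasTaylorSeries_schurIterate hM hM' hM'' n).apply_zero

end SchurSeries

/-! ### Families of matrices given by noncommutative rational expressions -/

section Rational

namespace NCRatExpr

/-- Renaming of the letters. -/
def rename {X Y : Type} (φ : X → Y) : NCRatExpr X → NCRatExpr Y
  | const c => const c
  | var x => var (φ x)
  | add p q => add (rename φ p) (rename φ q)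
  | mul p q => mul (rename φ p) (rename φ q)
  | inv p => inv (rename φ p)

variable {X Y : Type} {A : Type*} [Ring A] [Algebra ℂ A]

theorem eval_rename (φ : X → Y) (v : Y → A) (p : NCRatExpr X) :
    (p.rename φ).eval v = p.eval (v ∘ φ) := by
  induction p with
  | const c => rfl
  | var x => rfl
  | add p q hp hq => simp only [rename, eval, hp, hq]
  | mul p q hp hq => simp only [rename, eval, hp, hq]
  | inv p hp => simp only [rename, eval, hp]

theorem isDefinedAt_rename (φ : X → Y) (v : Y → A) (p : NCRatExpr X) :
    (p.rename φ).IsDefinedAt v ↔ p.IsDefinedAt (v ∘ φ) := by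
  induction p with
  | const c => rfl
  | var x => rfl
  | add p q hp hq => simp only [rename, IsDefinedAt, hp, hq]
  | mul p q hp hq => simp only [rename, IsDefinedAt, hp, hq]
  | inv p hp => simp only [rename, IsDefinedAt, hp, eval_rename]

end NCRatExpr

/-- The matrix `Φ d M` is the value of one noncommutative rational expression, independent of `d`
and `M`, in the letters `α_j, α_j^*, ρ_j^L, ρ_j^R` with `j < m`, for all positive, normalised and
nontrivial `M`. -/
def IsRational (m : ℕ) (Φ : ∀ d : ℕ, MatrixMeasure d → Matrix (Fin d) (Fin d) ℂ) : Prop :=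
  ∃ R : NCRatExpr (VerblunskyLetter m), ∀ (d : ℕ) (M : MatrixMeasure d),
    IsPositive M → IsNormalized M → IsNontrivial M →
      R.IsDefinedAt (letterValue (verblunsky M)) ∧ Φ d M = R.eval (letterValue (verblunsky M))

namespace IsRational

variable {m m' : ℕ} {Φ Ψ : ∀ d : ℕ, MatrixMeasure d → Matrix (Fin d) (Fin d) ℂ}

/-- It suffices to describe `Φ` on positive, normalised and nontrivial measures. -/
theorem congr (h : IsRational m Φ) (he : ∀ (d : ℕ) (M : MatrixMeasure d),
    IsPositive M → IsNormalized M → IsNontrivial M → Ψ d M = Φ d M) : IsRational m Ψ := by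
  obtain ⟨R, hR⟩ := h
  exact ⟨R, fun d M h1 h2 h3 => ⟨(hR d M h1 h2 h3).1, (he d M h1 h2 h3).trans (hR d M h1 h2 h3).2⟩⟩

theorem mono (h : IsRational m Φ) (hm : m ≤ m') : IsRational m' Φ := by
  obtain ⟨R, hR⟩ := h
  let φ : VerblunskyLetter m → VerblunskyLetter m'
    | .alpha j => .alpha (Fin.castLE hm j)
    | .alphaStar j => .alphaStar (Fin.castLE hm j)
    | .rhoL j => .rhoL (Fin.castLE hm j)
    | .rhoR j => .rhoR (Fin.castLE hm j)
  refine ⟨R.rename φ, fun d M h1 h2 h3 => ?_⟩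
  have hφ : (letterValue (verblunsky M) : VerblunskyLetter m' → _) ∘ φ =
      letterValue (verblunsky M) := by
    funext x
    cases x <;> rfl
  rw [NCRatExpr.isDefinedAt_rename, NCRatExpr.eval_rename, hφ]
  exact hR d M h1 h2 h3

theorem const (c : ℂ) : IsRational m fun d _ => algebraMap ℂ (Matrix (Fin d) (Fin d) ℂ) c :=
  ⟨.const c, fun _ _ _ _ _ => ⟨trivial, rfl⟩⟩

theorem zero : IsRational m fun _ _ => 0 :=
  (const 0).congr fun _ _ _ _ _ => (map_zero _).symm

theorem add (h₁ : IsRational m Φ) (h₂ : IsRational m Ψ) :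
    IsRational m fun d M => Φ d M + Ψ d M := by
  obtain ⟨R₁, h₁⟩ := h₁
  obtain ⟨R₂, h₂⟩ := h₂
  exact ⟨.add R₁ R₂, fun d M a b c => ⟨⟨(h₁ d M a b c).1, (h₂ d M a b c).1⟩,
    congrArg₂ _ (h₁ d M a b c).2 (h₂ d M a b c).2⟩⟩

theorem mul (h₁ : IsRational m Φ) (h₂ : IsRational m Ψ) :
    IsRational m fun d M => Φ d M * Ψ d M := by
  obtain ⟨R₁, h₁⟩ := h₁
  obtain ⟨R₂, h₂⟩ := h₂
  exact ⟨.mul R₁ R₂, fun d M a b c => ⟨⟨(h₁ d M a b c).1, (h₂ d M a b c).1⟩,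
    congrArg₂ _ (h₁ d M a b c).2 (h₂ d M a b c).2⟩⟩

theorem neg (h : IsRational m Φ) : IsRational m fun d M => -Φ d M :=
  ((const (-1)).mul h).congr fun _ _ _ _ _ => by simp

theorem sub (h₁ : IsRational m Φ) (h₂ : IsRational m Ψ) :
    IsRational m fun d M => Φ d M - Ψ d M :=
  (h₁.add h₂.neg).congr fun _ _ _ _ _ => sub_eq_add_neg _ _

theorem inv (h : IsRational m Φ) (hu : ∀ (d : ℕ) (M : MatrixMeasure d),
    IsPositive M → IsNormalized M → IsNontrivial M → IsUnit (Φ d M)) :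
    IsRational m fun d M => (Φ d M)⁻¹ := by
  obtain ⟨R, h⟩ := h
  refine ⟨.inv R, fun d M a b c => ⟨⟨(h d M a b c).1, ?_⟩, ?_⟩⟩
  · rw [← (h d M a b c).2]
    exact hu d M a b c
  · change _ = Ring.inverse _
    rw [← (h d M a b c).2]
    exact Matrix.nonsing_inv_eq_ringInverse _

theorem finsetSum {ι : Type*} (s : Finset ι)
    {Φ : ι → ∀ d : ℕ, MatrixMeasure d → Matrix (Fin d) (Fin d) ℂ}
    (h : ∀ i ∈ s, IsRational m (Φ i)) : IsRational m fun d M => ∑ i ∈ s, Φ i d M := by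
  classical
  induction s using Finset.induction_on with
  | empty => exact zero
  | insert a s ha ih =>
    refine ((h a (Finset.mem_insert_self a s)).add
      (ih fun i hi => h i (Finset.mem_insert_of_mem hi))).congr fun d M _ _ _ => ?_
    exact Finset.sum_insert ha

variable {j : ℕ}

theorem alpha (hj : j < m) : IsRational m fun _ M => verblunsky M j :=
  ⟨.var (.alpha ⟨j, hj⟩), fun _ _ _ _ _ => ⟨trivial, rfl⟩⟩

theorem alphaStar (hj : j < m) : IsRational m fun _ M => (verblunsky M j)ᴴ :=
  ⟨.var (.alphaStar ⟨j, hj⟩), fun _ _ _ _ _ => ⟨trivial, rfl⟩⟩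

theorem rhoL (hj : j < m) : IsRational m fun _ M => rhoL (verblunsky M j) :=
  ⟨.var (.rhoL ⟨j, hj⟩), fun _ _ _ _ _ => ⟨trivial, rfl⟩⟩

theorem rhoR (hj : j < m) : IsRational m fun _ M => rhoR (verblunsky M j) :=
  ⟨.var (.rhoR ⟨j, hj⟩), fun _ _ _ _ _ => ⟨trivial, rfl⟩⟩

end IsRational

end Rational

/-! ### Coefficients of the Schur functions and the moments -/

section Coefficients

open PowerSeries

variable {d : ℕ} {M : MatrixMeasure d}

theorem posDef_verblunsky (hM : IsPositive M) (hM' : IsNormalized M) (hM'' : IsNontrivial M)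
    (n : ℕ) : (1 - (verblunsky M n)ᴴ * verblunsky M n).PosDef := by
  rw [verblunsky_eq_coeff hM hM' hM'']
  exact (isStrictContraction_schurSeries hM hM' hM'' n).posDef

/-- The leading term `ρ_j^R ⋯ ρ_{j+k-1}^R α_{j+k} ρ_{j+k-1}^L ⋯ ρ_j^L` of the `k`-th Taylor
coefficient of the `j`-th Schur iterate. -/
noncomputable def leadingTerm (α : ℕ → Matrix (Fin d) (Fin d) ℂ) : ℕ → ℕ → Matrix (Fin d) (Fin d) ℂ
  | 0, j => α j
  | k + 1, j => rhoR (α j) * leadingTerm α k (j + 1) * rhoL (α j)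

theorem leadingTerm_zero_right (α : ℕ → Matrix (Fin d) (Fin d) ℂ) (k : ℕ) :
    leadingTerm α k 0 = prodRhoR α k * α k * prodRhoL α k := by
  have h : ∀ k j, leadingTerm α k j =
      ((List.range k).map fun i => rhoR (α (j + i))).prod * α (j + k) *
        ((List.range k).reverse.map fun i => rhoL (α (j + i))).prod := by
    intro k
    induction k with
    | zero => intro j; simp [leadingTerm]
    | succ k ih =>
      intro j
      rw [leadingTerm, ih, List.range_succ_eq_map]
      simp only [List.map_cons, List.prod_cons, List.map_map, List.reverse_cons, List.map_append,
        List.prod_append, List.map_nil, List.prod_nil, mul_one, add_zero, ← List.map_reverse,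
        Function.comp_def, Nat.succ_eq_add_one, add_right_comm j 1, add_assoc, mul_assoc]
  simpa [prodRhoR, prodRhoL] using h k 0

/-- The Schur algorithm on Taylor coefficients. -/
theorem coeff_succ_schurSeries (hM : IsPositive M) (hM' : IsNormalized M) (hM'' : IsNontrivial M)
    (j k : ℕ) : coeff (k + 1) (schurSeries M j) =
      rhoR (verblunsky M j) * coeff k (schurSeries M (j + 1)) * rhoL (verblunsky M j) -
      ∑ i ∈ Finset.range k, rhoR (verblunsky M j) * coeff i (schurSeries M (j + 1)) *
        (rhoL (verblunsky M j))⁻¹ *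
          ((verblunsky M j)ᴴ * coeff (k - i) (schurSeries M j)) := by
  have hc := isStrictContraction_schurSeries hM hM' hM'' j
  have hpos := posDef_verblunsky hM hM' hM'' j
  have hL := (Matrix.isUnit_iff_isUnit_det _).mp (isUnit_rhoL hpos)
  have h1 := congrArg (coeff (k + 1)) (sub_C_eq_schurSeriesStep hc)
  rw [← schurSeries_succ, ← verblunsky_eq_coeff hM hM' hM'', coeff_succ_X_mul, map_sub, coeff_C,
    if_neg (Nat.succ_ne_zero k), sub_zero] at h1
  rw [h1, coeff_mul, Finset.Nat.sum_antidiagonal_eq_sum_range_succ_mk, Finset.sum_range_succ,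
    add_comm, sub_eq_add_neg (_ * _ * rhoL _), ← Finset.sum_neg_distrib]
  congr 1
  · -- the constant coefficient `1 - α_j^* α_j` is the square of `ρ_j^L`, which cancels `(ρ_j^L)⁻¹`
    have h2 : coeff (k - k) (1 - C (verblunsky M j)ᴴ * schurSeries M j) =
        rhoL (verblunsky M j) * rhoL (verblunsky M j) := by
      rw [Nat.sub_self, map_sub, coeff_C_mul, ← verblunsky_eq_coeff hM hM' hM'', rhoL_mul_self hpos,
        coeff_zero_one]
    rw [h2, coeff_mul_C, coeff_C_mul, mul_assoc, Matrix.nonsing_inv_mul_cancel_left _ _ hL]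
  · refine Finset.sum_congr rfl fun i hi => ?_
    rw [Finset.mem_range] at hi
    rw [coeff_mul_C, coeff_C_mul, map_sub, coeff_C_mul, coeff_one, if_neg (by omega), zero_sub,
      mul_neg]

theorem isRational_leadingTerm (k : ℕ) {j m : ℕ} (h : j + k < m) :
    IsRational m fun _ M => leadingTerm (verblunsky M) k j := by
  induction k generalizing j with
  | zero => exact IsRational.alpha h
  | succ k ih =>
    exact ((IsRational.rhoR (by omega)).mul (ih (j := j + 1) (by omega))).mul
      (IsRational.rhoL (by omega))

/-- The `k`-th Taylor coefficient of the `j`-th Schur iterate is its leading term up to a rational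
expression in the Verblunsky coefficients of index less than `j + k`. -/
theorem isRational_coeff_schurSeries_sub (k : ℕ) : ∀ j : ℕ, IsRational (j + k) fun _ M =>
    coeff k (schurSeries M j) - leadingTerm (verblunsky M) k j := by
  induction k using Nat.strong_induction_on with
  | _ k ih =>
    have hfull : ∀ l < k, ∀ j m, j + l < m → IsRational m fun _ M =>
        coeff l (schurSeries M j) := fun l hl j m hm =>
      (((ih l hl j).mono (by omega)).add (isRational_leadingTerm l hm)).congr fun d M _ _ _ => by
        rw [sub_add_cancel]
    intro j
    cases k with
    | zero =>
      refine IsRational.zero.congr fun d M h1 h2 h3 => ?_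
      rw [leadingTerm, verblunsky_eq_coeff h1 h2 h3, sub_self]
    | succ k =>
      have hR : IsRational (j + (k + 1)) fun _ M => rhoR (verblunsky M j) :=
        IsRational.rhoR (by omega)
      have hL : IsRational (j + (k + 1)) fun _ M => rhoL (verblunsky M j) :=
        IsRational.rhoL (by omega)
      have hLinv : IsRational (j + (k + 1)) fun _ M => (rhoL (verblunsky M j))⁻¹ :=
        hL.inv fun d M h1 h2 h3 => isUnit_rhoL (posDef_verblunsky h1 h2 h3 j)
      have hsum : IsRational (j + (k + 1)) fun _ M => ∑ i ∈ Finset.range k,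
          rhoR (verblunsky M j) * coeff i (schurSeries M (j + 1)) * (rhoL (verblunsky M j))⁻¹ *
            ((verblunsky M j)ᴴ * coeff (k - i) (schurSeries M j)) := by
        refine IsRational.finsetSum _ fun i hi => ?_
        rw [Finset.mem_range] at hi
        exact ((hR.mul (hfull i (by omega) _ _ (by omega))).mul hLinv).mul
          ((IsRational.alphaStar (by omega)).mul (hfull (k - i) (by omega) _ _ (by omega)))
      refine (((hR.mul ((ih k (by omega) (j + 1)).mono (by omega))).mul hL).sub hsum).congr
        fun d M h1 h2 h3 => ?_
      rw [coeff_succ_schurSeries h1 h2 h3, leadingTerm, mul_sub, sub_mul]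
      abel

/-- The moments in terms of the Taylor coefficients of the Schur function. -/
theorem moment_succ_eq (M : MatrixMeasure d) (n : ℕ) :
    moment M (n + 1 : ℕ) = coeff n (schurSeries M 0) +
      ∑ i ∈ Finset.range n, coeff i (schurSeries M 0) * moment M (n - i : ℕ) := by
  have h0 := X_mul_schurSeries_zero_mul M
  have h := congrArg (coeff (n + 1)) h0
  have hF : ∀ k : ℕ, coeff (k + 1) (herglotzSeries M) = (2 : ℂ) • moment M (k + 1 : ℕ) := by
    intro k
    rw [herglotzSeries, map_add, coeff_succ_X_mul, coeff_mk, coeff_one,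
      if_neg (Nat.succ_ne_zero k), zero_add]
  have h1 : ∀ k : ℕ, k ≠ 0 → coeff k (herglotzSeries M + 1) = (2 : ℂ) • moment M (k : ℕ) := by
    intro k hk
    obtain ⟨k, rfl⟩ := Nat.exists_eq_succ_of_ne_zero hk
    rw [map_add, Nat.succ_eq_add_one, hF, coeff_one, if_neg (Nat.succ_ne_zero k), add_zero]
  have h2 : coeff 0 (herglotzSeries M + 1) = (2 : ℂ) • 1 := by
    rw [map_add, coeff_zero_herglotzSeries, coeff_zero_one, two_smul]
  rw [map_sub, hF, coeff_one, if_neg (Nat.succ_ne_zero n), sub_zero, mul_assoc, coeff_succ_X_mul,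
    coeff_mul, Finset.Nat.sum_antidiagonal_eq_sum_range_succ_mk, Finset.sum_range_succ, Nat.sub_self,
    h2, mul_smul_comm, mul_one] at h
  have h3 : ∑ i ∈ Finset.range n, coeff i (schurSeries M 0) *
      coeff (n - i) (herglotzSeries M + 1) =
      (2 : ℂ) • ∑ i ∈ Finset.range n, coeff i (schurSeries M 0) * moment M (n - i : ℕ) := by
    rw [Finset.smul_sum]
    refine Finset.sum_congr rfl fun i hi => ?_
    rw [Finset.mem_range] at hi
    rw [h1 _ (by omega), mul_smul_comm]
  rw [h3, ← smul_add] at h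
  rw [add_comm (coeff n _)]
  exact (smul_right_injective _ (two_ne_zero (α := ℂ)) h).symm

theorem isRational_coeff_schurSeries {k m : ℕ} (hk : k < m) :
    IsRational m fun _ M => coeff k (schurSeries M 0) := by
  refine (((isRational_coeff_schurSeries_sub k 0).mono (by omega)).add
    (isRational_leadingTerm k (j := 0) (by omega))).congr fun d M _ _ _ => ?_
  rw [sub_add_cancel]

theorem isRational_moment {n m : ℕ} (h0 : 0 < n) (hn : n ≤ m) :
    IsRational m fun _ M => moment M (n : ℕ) := by
  induction n using Nat.strong_induction_on with
  | _ n ih =>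
    obtain ⟨n, rfl⟩ := Nat.exists_eq_succ_of_ne_zero h0.ne'
    refine ((isRational_coeff_schurSeries (k := n) (by omega)).add
      (IsRational.finsetSum (Finset.range n) fun i hi => ?_)).congr
        fun d M _ _ _ => moment_succ_eq M n
    rw [Finset.mem_range] at hi
    exact (isRational_coeff_schurSeries (by omega)).mul (ih (n - i) (by omega) (by omega) (by omega))

end Coefficients

end MatrixOPUC

theorem mainTheorem2 (n : ℕ) (hn : 1 ≤ n) :
    ∃ R : MatrixOPUC.NCRatExpr (MatrixOPUC.VerblunskyLetter (n - 1)),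
      ∀ (d : ℕ) (M : MatrixOPUC.MatrixMeasure d),
        MatrixOPUC.IsPositive M → MatrixOPUC.IsNormalized M → MatrixOPUC.IsNontrivial M →
          R.IsDefinedAt (MatrixOPUC.letterValue (MatrixOPUC.verblunsky M)) ∧
          MatrixOPUC.moment M n =
            MatrixOPUC.prodRhoR (MatrixOPUC.verblunsky M) (n - 1) *
                MatrixOPUC.verblunsky M (n - 1) *
                MatrixOPUC.prodRhoL (MatrixOPUC.verblunsky M) (n - 1) +
              R.eval (MatrixOPUC.letterValue (MatrixOPUC.verblunsky M)) := by
  obtain ⟨n, rfl⟩ := Nat.exists_eq_add_of_le' hn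
  rw [Nat.add_sub_cancel]
  have hlead := MatrixOPUC.isRational_coeff_schurSeries_sub n 0
  rw [zero_add] at hlead
  obtain ⟨R, hR⟩ := hlead.add (MatrixOPUC.IsRational.finsetSum (Finset.range n) fun i hi =>
    (MatrixOPUC.isRational_coeff_schurSeries (Finset.mem_range.mp hi)).mul
      (MatrixOPUC.isRational_moment (Nat.sub_pos_of_lt (Finset.mem_range.mp hi)) (Nat.sub_le n i)))
  refine ⟨R, fun d M h1 h2 h3 => ⟨(hR d M h1 h2 h3).1, ?_⟩⟩
  rw [← (hR d M h1 h2 h3).2, MatrixOPUC.moment_succ_eq, ← MatrixOPUC.leadingTerm_zero_right]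
  beta_reduce
  abel
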